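/- **Theorem (singularity property).** Let $\eta\in\mathbb C$ with $\sinh\eta\neq0$, and $$f(u,v)=\frac{\sin(u-v+i\eta)}{\sin(u-v)},\qquad R(w)=\begin{pmatrix}1&0&0&0\\0&b(w)&c(w)&0\\0&c(w)&b(w)&0\\0&0&0&1\end{pmatrix},\qquad b(w)=\frac{\sin w}{\sin(w+i\eta)},\quad c(w)=\frac{\sin(i\eta)}{\sin(w+i\eta)} .$$ Consider the Yang–Baxter algebra generated by the entries of the monodromy matrices $T(u)=\begin{pmatrix}A(u)&B(u)\\C(u)&D(u)\end{pmatrix}$, $u$ in a family of spectral parameters, with the relations $T_a(u)T_b(v)R_{ab}(v-u)=R_{ab}(v-u)T_b(v)T_a(u)$ (with the denominator $\sin(v-u+i\eta)$ cleared). Let $|0\rangle$, $\langle0|$ be a vacuum and a dual vacuum with $\langle0|0\rangle=1$, $A(u)|0\rangle=a(u)|0\rangle$, $D(u)|0\rangle=d(u)|0\rangle$, $C(u)|0\rangle=0$, $\langle0|A(u)=a(u)\langle0|$, $\langle0|D(u)=d(u)\langle0|$, $\langle0|B(u)=0$; the vacuum eigenvalues at the different spectral parameters are independent complex variables. Put $\mathbb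 B(u)=B(u)/d(u)$, $\mathbb C(u)=C(u)/d(u)$, $l(u)=a(u)/d(u)$, with $d\ne0$ at the rapidities $\lambda^{B},\lambda^{C}$. For an operator $\mathcal O=X_1(\mu_1)\cdots X_M(\mu_M)$, $M\ge0$, each $X_k$ being one of $A,B,C,D$, and for $N\ge0$ consider $$M_N^{\mathcal O}=\langle0|\prod_{j=1}^N\mathbb C(\lambda_j^C)\;\mathcal O\;\prod_{j=1}^N\mathbb B(\lambda_j^B)|0\rangle .$$ (i) If $\lambda^C_1,\dots,\lambda^C_N,\lambda^B_1,\dots,\lambda^B_N,\mu_1,\dots,\mu_M$ are pairwise distinct modulo $\pi$, then $M_N^{\mathcal O}$ is well defined for arbitrary values of the vacuum eigenvalues at these points: a vacuum expectation value functional with these eigenvalues exists, and all such functionals give the same $M_N^{\mathcal O}$. At the points $\lambda^C_j,\lambda^B_j$ it depends on the vacuum eigenvalues only through $l^C_j=l(\lambda^C_j)$ and $l^B_j=l(\lambda_j^B)$. (ii) Let $N\ge1$, let $\lambda_1^C,\dots,\lambda_{N-1}^C,\lambda_1^B,\dots,\lambda_N^B,\mu_1,\dots,\mu_M$ be pairwise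 distinct modulo $\pi$, and suppose that $f(\lambda_k^C,\lambda_N^B)\ne0$ and $f(\lambda_k^B,\lambda_N^B)\neq0$ for $k<N$. As a function of $\lambda_N^C$, with all other variables (including $l_N^C$ and $l_N^B$) fixed, $$M_N^{\mathcal O}=\frac{i\sinh\eta}{\lambda_N^C-\lambda_N^B}\,\bigl(l_N^B-l_N^C\bigr)\prod_{k=1}^{N-1}f(\lambda_k^C,\lambda_N^B)\,f(\lambda_k^B,\lambda_N^B)\;M_{N-1}^{\mathcal O,\mathrm{mod}}+h(\lambda_N^C)$$ for all $\lambda_N^C\ne\lambda_N^B$ in a neighbourhood of $\lambda_N^B$, where $h$ is analytic at $\lambda_N^B$. Here $M_{N-1}^{\mathcal O,\mathrm{mod}}$ is the matrix element with $\lambda_N^C,\lambda_N^B$ removed, in which at all remaining points, including the $\mu_k$, the vacuum eigenvalues are replaced by $$a_{mod}(\lambda)=a(\lambda)f(\lambda_N^B,\lambda),\qquad d_{mod}(\lambda)=d(\lambda)f(\lambda,\lambda_N^B).$$ -/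

import Mathlib

noncomputable section

namespace XXZ

open Complex

/-- The function `f(u,v) = 1 / b(u-v) = sin(u-v+iη) / sin(u-v)` of the XXZ model. -/
def f (η u v : ℂ) : ℂ := sin (u - v + I * η) / sin (u - v)

/-- The `R`-matrix of the XXZ model on `ℂ² ⊗ ℂ²`, with its denominator cleared:
`sin(w+iη) R(w)`, where `R(w)` is the six-vertex matrix with entries `1`,
`b(w) = sin w / sin(w+iη)` and `c(w) = sin(iη) / sin(w+iη)`.
The row index is `(i, j)` and the column index is `(k, l)`; the first component belongs to the
first tensor factor. -/
def R (η w : ℂ) (i j k l : Fin 2) : ℂ :=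
  if i = k ∧ j = l then (if i = j then sin (w + I * η) else sin w)
  else if i = l ∧ j = k then sin (I * η) else 0

section Algebra

variable {ι : Type}

/-- The free generator `T_{ij}(u_p)`. -/
def freeT (p : ι) (i j : Fin 2) : FreeAlgebra ℂ (ι × Fin 2 × Fin 2) :=
  FreeAlgebra.ι ℂ (p, i, j)

/-- The relation `T_a(u) T_b(v) R_{ab}(v-u) = R_{ab}(v-u) T_b(v) T_a(u)`, entry by entry, for all
pairs `u = u_p`, `v = u_q` of a family of spectral parameters `u : ι → ℂ`. -/
inductive RTT (η : ℂ) (u : ι → ℂ) :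
    FreeAlgebra ℂ (ι × Fin 2 × Fin 2) → FreeAlgebra ℂ (ι × Fin 2 × Fin 2) → Prop
  | rtt (p q : ι) (i j k l : Fin 2) : RTT η u
      (∑ m : Fin 2, ∑ n : Fin 2, R η (u q - u p) m n k l • (freeT p i m * freeT q j n))
      (∑ m : Fin 2, ∑ n : Fin 2, R η (u q - u p) i j m n • (freeT q n l * freeT p m k))

/-- The Yang-Baxter algebra: the associative unital complex algebra generated by the entries of
the monodromy matrices `T(u_p)`, `p : ι`, with the `RTT` relations. -/
abbrev YBAlgebra (η : ℂ) (u : ι → ℂ) : Type := RingQuot (RTT η u)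

/-- The entry `T_{ij}(u_p)` of the monodromy matrix. -/
def T (η : ℂ) (u : ι → ℂ) (p : ι) (i j : Fin 2) : YBAlgebra η u :=
  RingQuot.mkAlgHom ℂ (RTT η u) (freeT p i j)

/-- The block `A(u) = T_{11}(u)` of the monodromy matrix `T(u) = (A(u) B(u); C(u) D(u))`. -/
def A (η : ℂ) (u : ι → ℂ) (p : ι) : YBAlgebra η u := T η u p 0 0

/-- The block `B(u) = T_{12}(u)` of the monodromy matrix. -/
def B (η : ℂ) (u : ι → ℂ) (p : ι) : YBAlgebra η u := T η u p 0 1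

/-- The block `C(u) = T_{21}(u)` of the monodromy matrix. -/
def C (η : ℂ) (u : ι → ℂ) (p : ι) : YBAlgebra η u := T η u p 1 0

/-- The block `D(u) = T_{22}(u)` of the monodromy matrix. -/
def D (η : ℂ) (u : ι → ℂ) (p : ι) : YBAlgebra η u := T η u p 1 1

/-- `φ X = ⟨0|X|0⟩` is a vacuum expectation value with vacuum eigenvalues `a`, `d`, i.e.
`⟨0|0⟩ = 1`, the vacuum satisfies `A|0⟩ = a|0⟩`, `D|0⟩ = d|0⟩`, `C|0⟩ = 0`, and the dual vacuum
satisfies `⟨0|A = a⟨0|`, `⟨0|D = d⟨0|`, `⟨0|B = 0`. Every representation of the Yang-Baxter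
algebra with a vacuum and a dual vacuum (for instance every spin chain) gives such a `φ`. -/
structure IsVacuumState (η : ℂ) (u a d : ι → ℂ) (φ : YBAlgebra η u →ₗ[ℂ] ℂ) : Prop where
  one : φ 1 = 1
  mul_A : ∀ X p, φ (X * A η u p) = a p * φ X
  mul_D : ∀ X p, φ (X * D η u p) = d p * φ X
  mul_C : ∀ X p, φ (X * C η u p) = 0
  A_mul : ∀ X p, φ (A η u p * X) = a p * φ X
  D_mul : ∀ X p, φ (D η u p * X) = d p * φ X
  B_mul : ∀ X p, φ (B η u p * X) = 0

open Classical in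
/-- The vacuum expectation value `⟨0|X|0⟩` with vacuum eigenvalues `a`, `d`. -/
def vev (η : ℂ) (u a d : ι → ℂ) (X : YBAlgebra η u) : ℂ :=
  if h : ∃ φ : YBAlgebra η u →ₗ[ℂ] ℂ, IsVacuumState η u a d φ then h.choose X else 0

end Algebra

/-- A spectral parameter, together with the values that the vacuum eigenvalue functions `a` and
`d` take at it. As `a` and `d` are arbitrary functions, these are three independent variables. -/
structure SpectralPoint where
  rap : ℂ
  a : ℂ
  d : ℂ

/-- The ratio `l = a / d`. -/
def SpectralPoint.l (s : SpectralPoint) : ℂ := s.a / s.d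

/-- The modification `a_mod(λ) = a(λ) f(v,λ)`, `d_mod(λ) = d(λ) f(λ,v)` of the vacuum
eigenvalues by the rapidity `v`. -/
def SpectralPoint.modify (η v : ℂ) (s : SpectralPoint) : SpectralPoint where
  rap := s.rap
  a := s.a * f η v s.rap
  d := s.d * f η s.rap v

/-- Rapidities are in generic position if they are pairwise distinct modulo `π`. -/
def Generic {ι : Type} (s : ι → SpectralPoint) : Prop :=
  ∀ p q, p ≠ q → sin ((s p).rap - (s q).rap) ≠ 0

section MatrixElement

variable {N M : ℕ}

/-- All spectral points of a matrix element: those of the dual state, of the state, and of the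
operator. -/
def points (c b : Fin N → SpectralPoint) (o : Fin M → SpectralPoint) :
    Fin N ⊕ Fin N ⊕ Fin M → SpectralPoint :=
  Sum.elim c (Sum.elim b o)

/-- The family of the rapidities of all spectral points. -/
def raps (c b : Fin N → SpectralPoint) (o : Fin M → SpectralPoint) :
    Fin N ⊕ Fin N ⊕ Fin M → ℂ :=
  fun p => (points c b o p).rap

/-- The element `∏_j 𝕔(λ_j^C) · X₁(μ₁) ⋯ X_M(μ_M) · ∏_j 𝔹(λ_j^B)` of the Yang-Baxter algebra,
where `𝔹 = B / d`, `𝕔 = C / d`, and `X_k` is the entry of the monodromy matrix with index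
`X k`. -/
def word (η : ℂ) (c b : Fin N → SpectralPoint)
    (X : Fin M → Fin 2 × Fin 2) (o : Fin M → SpectralPoint) : YBAlgebra η (raps c b o) :=
  (List.ofFn fun j : Fin N => ((c j).d)⁻¹ • C η (raps c b o) (Sum.inl j)).prod *
  (List.ofFn fun k : Fin M => T η (raps c b o) (Sum.inr (Sum.inr k)) (X k).1 (X k).2).prod *
  (List.ofFn fun j : Fin N => ((b j).d)⁻¹ • B η (raps c b o) (Sum.inr (Sum.inl j))).prod

/-- `φ` is a vacuum expectation value on the Yang-Baxter algebra of the spectral points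
`c`, `b`, `o`, with the vacuum eigenvalues carried by these points. -/
def IsVacuumStateAt (η : ℂ) (c b : Fin N → SpectralPoint) (o : Fin M → SpectralPoint)
    (φ : YBAlgebra η (raps c b o) →ₗ[ℂ] ℂ) : Prop :=
  IsVacuumState η (raps c b o) (fun p => (points c b o p).a) (fun p => (points c b o p).d) φ

/-- The matrix element `⟨0| ∏ 𝕔(λ^C) O ∏ 𝔹(λ^B) |0⟩` of `O = X₁(μ₁) ⋯ X_M(μ_M)`. -/
def matrixElement (η : ℂ) (c b : Fin N → SpectralPoint)
    (X : Fin M → Fin 2 × Fin 2) (o : Fin M → SpectralPoint) : ℂ :=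
  vev η (raps c b o) (fun p => (points c b o p).a) (fun p => (points c b o p).d) (word η c b X o)

end MatrixElement

end XXZ

end

/-!
# The singularity property of matrix elements of the XXZ model

A vacuum expectation value is studied through its values `Φ w` on words `w` in the entries of the
monodromy matrices (`IsWordState`). In a word that contains every spectral point at most once,
the rightmost letter other than `B` can be moved through the `B`s on its right until it acts on
the vacuum. As only differences of distinct rapidities occur in the denominators, the value on such
a word is determined by the vacuum eigenvalues. This normal ordering is formulated as an induction
principle, `word_induction`; it gives uniqueness together with the dependence on the ratios `a / d`
(`IsWordState.eq_prod_mul`).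

Existence for arbitrary eigenvalues (`exists_isVacuumState`): a `q`-oscillator has vacuum
eigenvalues that are arbitrary affine functions of `e^{2iu}`, the coproduct multiplies vacuum
eigenvalues, polynomials over `ℂ` split into linear factors, and polynomials in `e^{2iu}` take
arbitrary values at finitely many points that are distinct modulo `π`.

For the pole at `x = λ_N^C → v = λ_N^B`, the same induction shows that a word which does not
contain both `x` and `v` is regular at `x = v` (`regularAt_word`). Now let `w` be a word in the
other points and consider the residue of `⟨0|C(x) w B(v)|0⟩`. If `w = w' A(p)`, then
`A(p) B(v) = f(v, p) B(v) A(p) + ⋯`, where the omitted term is regular because it contains `v` only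
through its eigenvalue. Hence the residue at `w' A(p)` is `a(p) f(v, p)` times the residue at `w'`,
and similarly it is `d(p) f(p, v)` times it for `D`, and zero for a final `C` or an initial `B`.
So, as a functional of `w`, the residue satisfies the vacuum conditions with the modified
eigenvalues, and it is the modified vacuum expectation value times its value at `w = 1`, which is
`sin(iη) (a(v) d(x) - a(x) d(v))` (`regularAt_sub_pole`). The factors `f` of the final formula come
from the normalization of `B` and `C` by `d` instead of `d_mod`. The hypothesis `f(λ_k^C, v) ≠ 0`
also allows `C(x)` to be moved to the front of the word.
-/

namespace XXZ

open Complex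

/-! ### Words in the entries of the monodromy matrices -/

section Words

variable {ι : Type}

theorem rtt_relation (η : ℂ) (u : ι → ℂ) (p q : ι) (i j k l : Fin 2) :
    ∑ m : Fin 2, ∑ n : Fin 2, R η (u q - u p) m n k l • (T η u p i m * T η u q j n) =
      ∑ m : Fin 2, ∑ n : Fin 2, R η (u q - u p) i j m n • (T η u q n l * T η u p m k) := by
  have h := RingQuot.mkAlgHom_rel ℂ (RTT.rtt (η := η) (u := u) p q i j k l)
  simpa only [map_sum, map_smul, map_mul, T] using h

/-- The product `T_{i₁j₁}(u_{p₁}) ⋯ T_{iₙjₙ}(u_{pₙ})` of the word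
`[(p₁, i₁, j₁), …, (pₙ, iₙ, jₙ)]`. -/
noncomputable def monomial (η : ℂ) (u : ι → ℂ) (w : List (ι × Fin 2 × Fin 2)) : YBAlgebra η u :=
  (w.map fun t => T η u t.1 t.2.1 t.2.2).prod

/-- The properties of the values `Φ w = ⟨0|w|0⟩` of a vacuum state on words: the vacuum
conditions, and the exchange relations of the Yang-Baxter algebra that normal ordering uses,
multiplied by their denominators. This is the interface between the algebras at different
spectral parameters, since the type of `Φ` does not mention them. -/
structure IsWordState (η : ℂ) (u a d : ι → ℂ) (Φ : List (ι × Fin 2 × Fin 2) → ℂ) : Prop where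
  nil : Φ [] = 1
  append_A : ∀ w p, Φ (w ++ [(p, 0, 0)]) = a p * Φ w
  append_D : ∀ w p, Φ (w ++ [(p, 1, 1)]) = d p * Φ w
  append_C : ∀ w p, Φ (w ++ [(p, 1, 0)]) = 0
  cons_A : ∀ w p, Φ ((p, 0, 0) :: w) = a p * Φ w
  cons_D : ∀ w p, Φ ((p, 1, 1) :: w) = d p * Φ w
  cons_B : ∀ w p, Φ ((p, 0, 1) :: w) = 0
  A_B : ∀ w w' p q, sin (u q - u p) * Φ (w ++ (p, 0, 0) :: (q, 0, 1) :: w') =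
    sin (u q - u p + I * η) * Φ (w ++ (q, 0, 1) :: (p, 0, 0) :: w') -
      sin (I * η) * Φ (w ++ (p, 0, 1) :: (q, 0, 0) :: w')
  D_B : ∀ w w' p q, sin (u p - u q) * Φ (w ++ (p, 1, 1) :: (q, 0, 1) :: w') =
    sin (u p - u q + I * η) * Φ (w ++ (q, 0, 1) :: (p, 1, 1) :: w') -
      sin (I * η) * Φ (w ++ (p, 0, 1) :: (q, 1, 1) :: w')
  C_B : ∀ w w' p q, sin (u q - u p) * Φ (w ++ (p, 1, 0) :: (q, 0, 1) :: w') =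
    sin (u q - u p) * Φ (w ++ (q, 0, 1) :: (p, 1, 0) :: w') +
      sin (I * η) * (Φ (w ++ (q, 1, 1) :: (p, 0, 0) :: w') -
        Φ (w ++ (p, 1, 1) :: (q, 0, 0) :: w'))
  C_C : ∀ w w' p q, sin (u q - u p + I * η) * Φ (w ++ (p, 1, 0) :: (q, 1, 0) :: w') =
    sin (u q - u p + I * η) * Φ (w ++ (q, 1, 0) :: (p, 1, 0) :: w')

theorem IsVacuumState.isWordState {η : ℂ} {u a d : ι → ℂ} {φ : YBAlgebra η u →ₗ[ℂ] ℂ}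
    (h : IsVacuumState η u a d φ) : IsWordState η u a d fun w => φ (monomial η u w) := by
  have key : ∀ (w w' : List (ι × Fin 2 × Fin 2)) (p q : ι) (i j k l : Fin 2),
      ∑ m : Fin 2, ∑ n : Fin 2, R η (u q - u p) m n k l *
          φ (monomial η u (w ++ (p, i, m) :: (q, j, n) :: w')) =
        ∑ m : Fin 2, ∑ n : Fin 2, R η (u q - u p) i j m n *
          φ (monomial η u (w ++ (q, n, l) :: (p, m, k) :: w')) := by
    intro w w' p q i j k l
    have := congrArg (fun Y => φ (monomial η u w * Y * monomial η u w'))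
      (rtt_relation η u p q i j k l)
    simpa only [Finset.mul_sum, Finset.sum_mul, map_sum, mul_smul_comm, smul_mul_assoc, map_smul,
      smul_eq_mul, monomial, List.map_append, List.map_cons, List.prod_append, List.prod_cons,
      mul_assoc] using this
  refine ⟨?_, ?_, ?_, ?_, ?_, ?_, ?_, ?_, ?_, ?_, ?_⟩
  · simp [monomial, h.one]
  · intro w p; simpa [monomial, A] using h.mul_A _ p
  · intro w p; simpa [monomial, D] using h.mul_D _ p
  · intro w p; simpa [monomial, C] using h.mul_C _ p
  · intro w p; simpa [monomial, A] using h.A_mul _ p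
  · intro w p; simpa [monomial, D] using h.D_mul _ p
  · intro w p; simpa [monomial, B] using h.B_mul _ p
  · intro w w' p q
    have := key w w' p q 0 0 0 1
    simp [Fin.sum_univ_two, R] at this
    linear_combination this
  · intro w w' p q
    have := key w w' q p 0 1 1 1
    simp [Fin.sum_univ_two, R] at this
    linear_combination -this
  · intro w w' p q
    have := key w w' p q 1 0 0 1
    simp [Fin.sum_univ_two, R] at this
    linear_combination this
  · intro w w' p q
    simpa [Fin.sum_univ_two, R] using key w w' p q 1 1 0 0

/-- Normal ordering as an induction principle for words in which no spectral point is repeated.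
It uses only the vacuum conditions for `A|0⟩`, `D|0⟩`, `C|0⟩`, `⟨0|B`, and the exchange of
`A`, `D`, `C` with a `B` on their right. -/
theorem word_induction {P : List (ι × Fin 2 × Fin 2) → Prop}
    (nil : P [])
    (append_A : ∀ w p, (w.map Prod.fst ++ [p]).Nodup → P w → P (w ++ [(p, 0, 0)]))
    (append_D : ∀ w p, (w.map Prod.fst ++ [p]).Nodup → P w → P (w ++ [(p, 1, 1)]))
    (append_C : ∀ w p, (w.map Prod.fst ++ [p]).Nodup → P (w ++ [(p, 1, 0)]))
    (cons_B : ∀ w p, (p :: w.map Prod.fst).Nodup → P ((p, 0, 1) :: w))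
    (A_B : ∀ w w' p q, p ≠ q → P (w ++ (q, 0, 1) :: (p, 0, 0) :: w') →
      P (w ++ (p, 0, 1) :: (q, 0, 0) :: w') → P (w ++ (p, 0, 0) :: (q, 0, 1) :: w'))
    (D_B : ∀ w w' p q, p ≠ q → P (w ++ (q, 0, 1) :: (p, 1, 1) :: w') →
      P (w ++ (p, 0, 1) :: (q, 1, 1) :: w') → P (w ++ (p, 1, 1) :: (q, 0, 1) :: w'))
    (C_B : ∀ w w' p q, p ≠ q → P (w ++ (q, 0, 1) :: (p, 1, 0) :: w') →
      P (w ++ (q, 1, 1) :: (p, 0, 0) :: w') → P (w ++ (p, 1, 1) :: (q, 0, 0) :: w') →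
      P (w ++ (p, 1, 0) :: (q, 0, 1) :: w'))
    (w : List (ι × Fin 2 × Fin 2)) (hw : (w.map Prod.fst).Nodup) : P w := by
  obtain ⟨n, hn⟩ : ∃ n, w.length = n := ⟨_, rfl⟩
  induction n using Nat.strong_induction_on generalizing w with
  | _ n ih =>
  -- the claim for a letter other than `B` followed by `B`s only, by induction on their number
  have claim : ∀ (t : List ι) (w : List (ι × Fin 2 × Fin 2)) (p : ι) (i j : Fin 2),
      (i, j) ≠ (0, 1) → (w ++ (p, i, j) :: t.map fun r => (r, (0 : Fin 2), (1 : Fin 2))).length = n →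
      ((w ++ (p, i, j) :: t.map fun r => (r, (0 : Fin 2), (1 : Fin 2))).map Prod.fst).Nodup →
      P (w ++ (p, i, j) :: t.map fun r => (r, 0, 1)) := by
    intro t
    induction t with
    | nil =>
      intro w p i j hij hl hnd
      have hP : P w := by
        refine ih w.length (by rw [← hl]; simp) w ?_ rfl
        rw [List.map_append] at hnd
        exact hnd.of_append_left
      have hnd' : (w.map Prod.fst ++ [p]).Nodup := by simpa using hnd
      fin_cases i <;> fin_cases j
      · exact append_A w p hnd' hP
      · exact absurd rfl hij
      · exact append_C w p hnd'
      · exact append_D w p hnd' hP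
    | cons q t iht =>
      intro w p i j hij hl hnd
      have step : ∀ (r s : ι) (i j k l : Fin 2), (k, l) ≠ (0, 1) →
          [r, s].Perm [p, q] →
          P (w ++ (r, i, j) :: (s, k, l) :: t.map fun r => (r, 0, 1)) := by
        intro r s i j k l hkl hrs
        have := iht (w ++ [(r, i, j)]) s k l hkl ?_ ?_
        · simpa using this
        · simpa using hl
        · refine (List.Perm.nodup_iff ?_).mpr hnd
          simpa using List.Perm.append_left (w.map Prod.fst)
            (List.Perm.append_right _ hrs)
      have hpq : p ≠ q := by
        rw [List.map_append] at hnd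
        have := hnd.of_append_right
        simp at this
        tauto
      have h1 : [p, q].Perm [p, q] := List.Perm.refl _
      have h2 : [q, p].Perm [p, q] := List.Perm.swap _ _ _
      fin_cases i <;> fin_cases j
      · exact A_B _ _ _ _ hpq (step _ _ _ _ _ _ (by decide) h2) (step _ _ _ _ _ _ (by decide) h1)
      · exact absurd rfl hij
      · exact C_B _ _ _ _ hpq (step _ _ _ _ _ _ (by decide) h2)
          (step _ _ _ _ _ _ (by decide) h2) (step _ _ _ _ _ _ (by decide) h1)
      · exact D_B _ _ _ _ hpq (step _ _ _ _ _ _ (by decide) h2) (step _ _ _ _ _ _ (by decide) h1)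
  have decomp : ∀ w : List (ι × Fin 2 × Fin 2),
      (∃ t : List ι, w = t.map fun r => (r, 0, 1)) ∨
      ∃ (t : List ι) (w' : List (ι × Fin 2 × Fin 2)) (p : ι) (i j : Fin 2),
        (i, j) ≠ (0, 1) ∧ w = w' ++ (p, i, j) :: t.map fun r => (r, 0, 1) := by
    intro w
    induction w with
    | nil => exact Or.inl ⟨[], rfl⟩
    | cons x w ihw =>
      obtain ⟨p, i, j⟩ := x
      rcases ihw with ⟨t, rfl⟩ | ⟨t, w', q, k, l, hkl, rfl⟩
      · by_cases hij : (i, j) = (0, 1)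
        · obtain ⟨rfl, rfl⟩ := Prod.mk.inj hij
          exact Or.inl ⟨p :: t, rfl⟩
        · exact Or.inr ⟨t, [], p, i, j, hij, rfl⟩
      · exact Or.inr ⟨t, (p, i, j) :: w', q, k, l, hkl, rfl⟩
  rcases decomp w with ⟨t, rfl⟩ | ⟨t, w', p, i, j, hij, rfl⟩
  · cases t with
    | nil => exact nil
    | cons p t => exact cons_B _ _ (by simpa using hw)
  · exact claim t w' p i j hij hn hw

/-- Multiplying both vacuum eigenvalues at each point `p` by `κ p` multiplies the value on a word
without repeated points by the product of its `κ`'s. With `κ = 1` this is the uniqueness of the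
vacuum expectation value on such words. -/
theorem IsWordState.eq_prod_mul {η : ℂ} {u a d a' d' κ : ι → ℂ}
    {Φ Φ' : List (ι × Fin 2 × Fin 2) → ℂ} (hu : ∀ p q, p ≠ q → sin (u p - u q) ≠ 0)
    (h : IsWordState η u a d Φ) (h' : IsWordState η u a' d' Φ')
    (ha : ∀ p, a' p = κ p * a p) (hd : ∀ p, d' p = κ p * d p)
    (w : List (ι × Fin 2 × Fin 2)) (hw : (w.map Prod.fst).Nodup) :
    Φ' w = (w.map fun t => κ t.1).prod * Φ w := by
  refine word_induction (P := fun w => Φ' w = (w.map fun t => κ t.1).prod * Φ w)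
    ?_ ?_ ?_ ?_ ?_ ?_ ?_ ?_ w hw
  · simp [h.nil, h'.nil]
  · intro w p _ ih
    rw [h.append_A, h'.append_A, ih, ha]; simp; ring
  · intro w p _ ih
    rw [h.append_D, h'.append_D, ih, hd]; simp; ring
  · intro w p _
    rw [h.append_C, h'.append_C]; simp
  · intro w p _
    rw [h.cons_B, h'.cons_B]; simp
  · intro w w' p q hpq h1 h2
    apply mul_left_cancel₀ (hu q p hpq.symm)
    rw [h'.A_B, h1, h2]
    simp only [List.map_append, List.map_cons, List.prod_append, List.prod_cons]
    linear_combination -((w.map fun t => κ t.1).prod * (κ p * κ q * (w'.map fun t => κ t.1).prod)) *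
      h.A_B w w' p q
  · intro w w' p q hpq h1 h2
    apply mul_left_cancel₀ (hu p q hpq)
    rw [h'.D_B, h1, h2]
    simp only [List.map_append, List.map_cons, List.prod_append, List.prod_cons]
    linear_combination -((w.map fun t => κ t.1).prod * (κ p * κ q * (w'.map fun t => κ t.1).prod)) *
      h.D_B w w' p q
  · intro w w' p q hpq h1 h2 h3
    apply mul_left_cancel₀ (hu q p hpq.symm)
    rw [h'.C_B, h1, h2, h3]
    simp only [List.map_append, List.map_cons, List.prod_append, List.prod_cons]
    linear_combination -((w.map fun t => κ t.1).prod * (κ p * κ q * (w'.map fun t => κ t.1).prod)) *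
      h.C_B w w' p q

end Words

end XXZ

namespace XXZ

open Complex

/-! ### Existence of vacuum states -/

section Existence

open scoped TensorProduct

variable {ι : Type}

/-- The algebra homomorphism out of the Yang-Baxter algebra given by monodromy matrices `L p`
over `S` that satisfy the `RTT` relations. -/
noncomputable def liftT {η : ℂ} {u : ι → ℂ} {S : Type*} [Semiring S] [Algebra ℂ S]
    (L : ι → Fin 2 → Fin 2 → S)
    (hL : ∀ p q i j k l, ∑ m : Fin 2, ∑ n : Fin 2, R η (u q - u p) m n k l • (L p i m * L q j n) =
      ∑ m : Fin 2, ∑ n : Fin 2, R η (u q - u p) i j m n • (L q n l * L p m k)) :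
    YBAlgebra η u →ₐ[ℂ] S :=
  RingQuot.liftAlgHom ℂ ⟨FreeAlgebra.lift ℂ fun t => L t.1 t.2.1 t.2.2, by
    rintro _ _ ⟨p, q, i, j, k, l⟩
    simpa [freeT] using hL p q i j k l⟩

theorem liftT_T {η : ℂ} {u : ι → ℂ} {S : Type*} [Semiring S] [Algebra ℂ S]
    (L : ι → Fin 2 → Fin 2 → S)
    (hL : ∀ p q i j k l, ∑ m : Fin 2, ∑ n : Fin 2, R η (u q - u p) m n k l • (L p i m * L q j n) =
      ∑ m : Fin 2, ∑ n : Fin 2, R η (u q - u p) i j m n • (L q n l * L p m k))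
    (p : ι) (i j : Fin 2) : liftT L hL (T η u p i j) = L p i j := by
  rw [liftT, T, RingQuot.liftAlgHom_mkAlgHom_apply, freeT, FreeAlgebra.lift_ι_apply]

/-- The coproduct `T_{ij} ↦ ∑ₘ T_{im} ⊗ T_{mj}` of the Yang-Baxter algebra. -/
noncomputable def comulT (η : ℂ) (u : ι → ℂ) :
    YBAlgebra η u →ₐ[ℂ] YBAlgebra η u ⊗[ℂ] YBAlgebra η u :=
  liftT (fun p i j => ∑ m : Fin 2, T η u p i m ⊗ₜ T η u p m j) <| by
    intro p q i j k l
    -- first the relation in the second tensor factor, then the one in the first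
    have h1 : ∀ a b, ∑ m : Fin 2, ∑ n : Fin 2, R η (u q - u p) m n k l •
        ((T η u p i a * T η u q j b) ⊗ₜ[ℂ] (T η u p a m * T η u q b n)) =
        ∑ m : Fin 2, ∑ n : Fin 2, R η (u q - u p) a b m n •
        ((T η u p i a * T η u q j b) ⊗ₜ[ℂ] (T η u q n l * T η u p m k)) := by
      intro a b
      have := congrArg (fun Y => (T η u p i a * T η u q j b) ⊗ₜ[ℂ] Y)
        (rtt_relation η u p q a b k l)
      simpa only [TensorProduct.tmul_sum, TensorProduct.tmul_smul] using this
    have h2 : ∀ m n, ∑ a : Fin 2, ∑ b : Fin 2, R η (u q - u p) a b m n •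
        ((T η u p i a * T η u q j b) ⊗ₜ[ℂ] (T η u q n l * T η u p m k)) =
        ∑ a : Fin 2, ∑ b : Fin 2, R η (u q - u p) i j a b •
        ((T η u q b n * T η u p a m) ⊗ₜ[ℂ] (T η u q n l * T η u p m k)) := by
      intro m n
      have := congrArg (fun Y => Y ⊗ₜ[ℂ] (T η u q n l * T η u p m k))
        (rtt_relation η u p q i j m n)
      simpa only [TensorProduct.sum_tmul, TensorProduct.smul_tmul'] using this
    calc
      _ = ∑ a : Fin 2, ∑ b : Fin 2, ∑ m : Fin 2, ∑ n : Fin 2, R η (u q - u p) m n k l •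
          ((T η u p i a * T η u q j b) ⊗ₜ[ℂ] (T η u p a m * T η u q b n)) := by
        simp only [Fin.sum_univ_two, add_mul, mul_add, Algebra.TensorProduct.tmul_mul_tmul,
          smul_add]
        abel
      _ = ∑ a : Fin 2, ∑ b : Fin 2, ∑ m : Fin 2, ∑ n : Fin 2, R η (u q - u p) a b m n •
          ((T η u p i a * T η u q j b) ⊗ₜ[ℂ] (T η u q n l * T η u p m k)) := by
        simp only [h1]
      _ = ∑ m : Fin 2, ∑ n : Fin 2, ∑ a : Fin 2, ∑ b : Fin 2, R η (u q - u p) a b m n •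
          ((T η u p i a * T η u q j b) ⊗ₜ[ℂ] (T η u q n l * T η u p m k)) := by
        simp only [Fin.sum_univ_two]
        abel
      _ = ∑ m : Fin 2, ∑ n : Fin 2, ∑ a : Fin 2, ∑ b : Fin 2, R η (u q - u p) i j a b •
          ((T η u q b n * T η u p a m) ⊗ₜ[ℂ] (T η u q n l * T η u p m k)) := by
        simp only [h2]
      _ = _ := by
        simp only [Fin.sum_univ_two, add_mul, mul_add, Algebra.TensorProduct.tmul_mul_tmul,
          smul_add]
        abel

/-- `a` and `d` are the vacuum eigenvalues of a vacuum state. -/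
def IsVacuumPair (η : ℂ) (u a d : ι → ℂ) : Prop :=
  ∃ φ : YBAlgebra η u →ₗ[ℂ] ℂ, IsVacuumState η u a d φ

/-- The product of two vacuum states along the coproduct is a vacuum state: vacuum eigenvalues
multiply. -/
theorem IsVacuumPair.mul {η : ℂ} {u a d a' d' : ι → ℂ} (h : IsVacuumPair η u a d)
    (h' : IsVacuumPair η u a' d') : IsVacuumPair η u (a * a') (d * d') := by
  obtain ⟨φ, h⟩ := h
  obtain ⟨ψ, h'⟩ := h'
  let Ψ : YBAlgebra η u ⊗[ℂ] YBAlgebra η u →ₗ[ℂ] ℂ :=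
    LinearMap.mul' ℂ ℂ ∘ₗ TensorProduct.map φ ψ
  have hΨ : ∀ X Y, Ψ (X ⊗ₜ Y) = φ X * ψ Y := fun X Y => by simp [Ψ]
  have hΔ : ∀ p i j, comulT η u (T η u p i j) =
      T η u p i 0 ⊗ₜ T η u p 0 j + T η u p i 1 ⊗ₜ T η u p 1 j := fun p i j => by
    rw [comulT, liftT_T, Fin.sum_univ_two]
  have right : ∀ (t : YBAlgebra η u ⊗[ℂ] YBAlgebra η u) (Z : YBAlgebra η u ⊗[ℂ] YBAlgebra η u)
      (c : ℂ), (∀ X Y, Ψ (X ⊗ₜ Y * Z) = c * Ψ (X ⊗ₜ Y)) → Ψ (t * Z) = c * Ψ t := by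
    intro t Z c hZ
    induction t using TensorProduct.induction_on with
    | zero => simp
    | tmul X Y => exact hZ X Y
    | add s t hs ht => rw [add_mul, map_add, hs, ht, map_add, mul_add]
  have left : ∀ (t : YBAlgebra η u ⊗[ℂ] YBAlgebra η u) (Z : YBAlgebra η u ⊗[ℂ] YBAlgebra η u)
      (c : ℂ), (∀ X Y, Ψ (Z * X ⊗ₜ Y) = c * Ψ (X ⊗ₜ Y)) → Ψ (Z * t) = c * Ψ t := by
    intro t Z c hZ
    induction t using TensorProduct.induction_on with
    | zero => simp
    | tmul X Y => exact hZ X Y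
    | add s t hs ht => rw [mul_add, map_add, hs, ht, map_add, mul_add]
  have mA := h.mul_A; have mD := h.mul_D; have mC := h.mul_C
  have Am := h.A_mul; have Dm := h.D_mul; have Bm := h.B_mul
  have mA' := h'.mul_A; have mD' := h'.mul_D; have mC' := h'.mul_C
  have Am' := h'.A_mul; have Dm' := h'.D_mul; have Bm' := h'.B_mul
  simp only [A, B, C, D] at mA mD mC Am Dm Bm mA' mD' mC' Am' Dm' Bm'
  refine ⟨Ψ ∘ₗ (comulT η u).toLinearMap, ?_, ?_, ?_, ?_, ?_, ?_, ?_⟩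
  · simp [Algebra.TensorProduct.one_def, hΨ, h.one, h'.one]
  · intro X p
    simp only [A, LinearMap.comp_apply, AlgHom.toLinearMap_apply, map_mul, hΔ]
    refine right _ _ _ fun X Y => ?_
    simp only [mul_add, Algebra.TensorProduct.tmul_mul_tmul, map_add, hΨ, mA, mA', mC', Pi.mul_apply]
    ring
  · intro X p
    simp only [D, LinearMap.comp_apply, AlgHom.toLinearMap_apply, map_mul, hΔ]
    refine right _ _ _ fun X Y => ?_
    simp only [mul_add, Algebra.TensorProduct.tmul_mul_tmul, map_add, hΨ, mD, mD', mC, Pi.mul_apply]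
    ring
  · intro X p
    simp only [C, LinearMap.comp_apply, AlgHom.toLinearMap_apply, map_mul, hΔ]
    refine (right _ _ 0 fun X Y => ?_).trans (zero_mul _)
    simp only [mul_add, Algebra.TensorProduct.tmul_mul_tmul, map_add, hΨ, mC, mC']
    ring
  · intro X p
    simp only [A, LinearMap.comp_apply, AlgHom.toLinearMap_apply, map_mul, hΔ]
    refine left _ _ _ fun X Y => ?_
    simp only [add_mul, Algebra.TensorProduct.tmul_mul_tmul, map_add, hΨ, Am, Am', Bm, Pi.mul_apply]
    ring
  · intro X p
    simp only [D, LinearMap.comp_apply, AlgHom.toLinearMap_apply, map_mul, hΔ]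
    refine left _ _ _ fun X Y => ?_
    simp only [add_mul, Algebra.TensorProduct.tmul_mul_tmul, map_add, hΨ, Dm, Dm', Bm', Pi.mul_apply]
    ring
  · intro X p
    simp only [B, LinearMap.comp_apply, AlgHom.toLinearMap_apply, map_mul, hΔ]
    refine (left _ _ 0 fun X Y => ?_).trans (zero_mul _)
    simp only [add_mul, Algebra.TensorProduct.tmul_mul_tmul, map_add, hΨ, Bm, Bm']
    ring

/-- The coefficients `c k` with `E e_{k+1} = c (k+1) e_k`, which make `E F - F E` the operator
required by the exchange relation of `C` and `B`. -/
noncomputable def lowerCoeff (q α β γ δ : ℂ) (k : ℕ) : ℂ :=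
  ∑ m ∈ Finset.range k, (q - q⁻¹) * (γ * β * (q ^ m) ^ 2 - α * δ * ((q ^ m)⁻¹) ^ 2)

/-- The local monodromy matrix of a (possibly degenerate) `q`-oscillator at multiplicative spectral
parameter `z = e^{iu}`, acting on sequences `x : ℕ → ℂ`: `A` and `D` are diagonal, `B` is the
raising and `C` the lowering operator. -/
noncomputable def oscillator (q α β γ δ z : ℂ) : Fin 2 → Fin 2 → Module.End ℂ (ℕ → ℂ)
  | 0, 0 =>
    { toFun := fun x k => (α * z ^ 2 * (q ^ k)⁻¹ + β * q ^ k) * x k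
      map_add' := fun x y => by funext k; simp; ring
      map_smul' := fun c x => by funext k; simp; ring }
  | 0, 1 =>
    { toFun := fun x k => z * Nat.casesOn k 0 x
      map_add' := fun x y => by funext k; cases k <;> simp; ring
      map_smul' := fun c x => by funext k; cases k <;> simp; ring }
  | 1, 0 =>
    { toFun := fun x k => z * lowerCoeff q α β γ δ (k + 1) * x (k + 1)
      map_add' := fun x y => by funext k; simp; ring
      map_smul' := fun c x => by funext k; simp; ring }
  | 1, 1 =>
    { toFun := fun x k => (γ * z ^ 2 * q ^ k + δ * (q ^ k)⁻¹) * x k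
      map_add' := fun x y => by funext k; simp; ring
      map_smul' := fun c x => by funext k; simp; ring }

theorem oscillator_rtt (η α β γ δ : ℂ) (s t : ℂ) (i j k l : Fin 2) :
    ∑ m : Fin 2, ∑ n : Fin 2, R η (t - s) m n k l •
      (oscillator (exp (-η)) α β γ δ (exp (I * s)) i m *
        oscillator (exp (-η)) α β γ δ (exp (I * t)) j n) =
    ∑ m : Fin 2, ∑ n : Fin 2, R η (t - s) i j m n •
      (oscillator (exp (-η)) α β γ δ (exp (I * t)) n l *
        oscillator (exp (-η)) α β γ δ (exp (I * s)) m k) := by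
  set q := exp (-η) with hq
  set y := exp (I * s) with hy
  set z := exp (I * t) with hz
  have hq0 : q ≠ 0 := exp_ne_zero _
  have hy0 : y ≠ 0 := exp_ne_zero _
  have hz0 : z ≠ 0 := exp_ne_zero _
  have hII : I * I = -1 := I_mul_I
  have s1 : sin (t - s) = (y / z - z / y) * (I / 2) := by
    rw [sin, hy, hz, ← exp_sub, ← exp_sub]
    rw [show -(t - s) * I = I * s - I * t by ring, show (t - s) * I = I * t - I * s by ring]
    ring
  have s2 : sin (t - s + I * η) = (y / (z * q) - z * q / y) * (I / 2) := by
    rw [sin, hy, hz, hq, ← exp_add, ← exp_sub, ← exp_sub]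
    rw [show -(t - s + I * η) * I = I * s - (I * t + -η) by linear_combination -η * hII,
      show (t - s + I * η) * I = I * t + -η - I * s by linear_combination η * hII]
    ring
  have s3 : sin (I * η) = (1 / q - q) * (I / 2) := by
    rw [sin, hq, one_div, ← exp_neg]
    rw [show -(I * η) * I = - -η by linear_combination -η * hII,
      show (I * η) * I = -η by linear_combination η * hII]
    ring
  apply LinearMap.ext
  intro x
  funext n
  have hlow : ∀ m, lowerCoeff q α β γ δ (m + 1) = lowerCoeff q α β γ δ m +
      (q - q⁻¹) * (γ * β * (q ^ m) ^ 2 - α * δ * ((q ^ m)⁻¹) ^ 2) := fun m => by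
    rw [lowerCoeff, Finset.sum_range_succ, lowerCoeff]
  have h0 : lowerCoeff q α β γ δ 0 = 0 := by simp [lowerCoeff]
  simp only [Fin.sum_univ_two, LinearMap.add_apply, LinearMap.smul_apply, Pi.add_apply,
    Pi.smul_apply, smul_eq_mul, Module.End.mul_apply]
  -- the vacuum component `n = 0` is special, because `B` has no component there
  rcases n with - | n
  · have h1 := hlow 0
    rw [h0, pow_zero] at h1
    clear_value q y z
    clear hlow h0
    fin_cases i <;> fin_cases j <;> fin_cases k <;> fin_cases l <;>
      simp [R, oscillator, s1, s2, s3, h1] <;>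
      first | done | (left; ring1) | (field_simp <;> ring1)
  · have h1 := hlow (n + 1)
    have hn : q ^ n ≠ 0 := pow_ne_zero _ hq0
    clear_value q y z
    fin_cases i <;> fin_cases j <;> fin_cases k <;> fin_cases l <;>
      simp [R, oscillator, s1, s2, s3, h1, pow_succ] <;>
      generalize q ^ n = Q at hn ⊢ <;>
      first | done | (left; ring1) | (field_simp <;> ring1)

/-- A single oscillator has affine functions of `e^{2iu}` as vacuum eigenvalues. -/
theorem isVacuumPair_affine (η : ℂ) (u : ι → ℂ) (α β γ δ : ℂ) :
    IsVacuumPair η u (fun p => α * exp (I * u p) ^ 2 + β)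
      (fun p => γ * exp (I * u p) ^ 2 + δ) := by
  let ρ : YBAlgebra η u →ₐ[ℂ] Module.End ℂ (ℕ → ℂ) :=
    liftT (fun p => oscillator (exp (-η)) α β γ δ (exp (I * u p)))
      fun p q => oscillator_rtt η α β γ δ (u p) (u q)
  have hρ : ∀ p i j, ρ (T η u p i j) = oscillator (exp (-η)) α β γ δ (exp (I * u p)) i j :=
    fun p i j => liftT_T _ _ p i j
  -- the vacuum is the sequence supported at `0`, the dual vacuum is the evaluation at `0`
  have hA : ∀ p, ρ (T η u p 0 0) (Pi.single 0 1) =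
      (α * exp (I * u p) ^ 2 + β) • Pi.single 0 1 := fun p => by
    rw [hρ]
    funext k
    cases k <;> simp [oscillator]
  have hD : ∀ p, ρ (T η u p 1 1) (Pi.single 0 1) =
      (γ * exp (I * u p) ^ 2 + δ) • Pi.single 0 1 := fun p => by
    rw [hρ]
    funext k
    cases k <;> simp [oscillator]
  have hC : ∀ p, ρ (T η u p 1 0) (Pi.single 0 1) = 0 := fun p => by
    rw [hρ]
    funext k
    simp [oscillator]
  refine ⟨LinearMap.proj 0 ∘ₗ LinearMap.applyₗ (Pi.single 0 1) ∘ₗ ρ.toLinearMap,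
    ?_, ?_, ?_, ?_, ?_, ?_, ?_⟩
  · simp
  · intro X p
    simp [A, Module.End.mul_apply, hA]
  · intro X p
    simp [D, Module.End.mul_apply, hD]
  · intro X p
    simp [C, Module.End.mul_apply, hC]
  · intro X p
    simp [A, Module.End.mul_apply, hρ, oscillator]
  · intro X p
    simp [D, Module.End.mul_apply, hρ, oscillator]
  · intro X p
    simp [B, Module.End.mul_apply, hρ, oscillator]

theorem isVacuumPair_multiset_prod (η : ℂ) (u : ι → ℂ) (s : Multiset ℂ) :
    IsVacuumPair η u (fun p => (s.map fun r => exp (I * u p) ^ 2 - r).prod) 1 ∧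
    IsVacuumPair η u 1 (fun p => (s.map fun r => exp (I * u p) ^ 2 - r).prod) := by
  induction s using Multiset.induction_on with
  | empty =>
    have h : IsVacuumPair η u 1 1 := by
      convert isVacuumPair_affine η u 0 1 0 1 using 1 <;> funext p <;> simp
    simp only [Multiset.map_zero, Multiset.prod_zero]
    exact ⟨h, h⟩
  | cons r s ih =>
    constructor
    · convert (isVacuumPair_affine η u 1 (-r) 0 1).mul ih.1 using 1 <;> funext p <;>
        simp [sub_eq_add_neg]
    · convert (isVacuumPair_affine η u 0 1 1 (-r)).mul ih.2 using 1 <;> funext p <;>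
        simp [sub_eq_add_neg]

/-- Any polynomials in `e^{2iu}` are vacuum eigenvalues: they split into linear factors. -/
theorem isVacuumPair_polynomial (η : ℂ) (u : ι → ℂ) (P Q : Polynomial ℂ) :
    IsVacuumPair η u (fun p => P.eval (exp (I * u p) ^ 2)) (fun p => Q.eval (exp (I * u p) ^ 2)) := by
  convert ((isVacuumPair_affine η u 0 P.leadingCoeff 0 Q.leadingCoeff).mul
    (isVacuumPair_multiset_prod η u P.roots).1).mul
    (isVacuumPair_multiset_prod η u Q.roots).2 using 1 <;> funext p
  · simp [(IsAlgClosed.splits P).eval_eq_prod_roots]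
  · simp [(IsAlgClosed.splits Q).eval_eq_prod_roots]

/-- At finitely many points that are distinct modulo `π` the vacuum eigenvalues can be prescribed
arbitrarily, by Lagrange interpolation in `e^{2iu}`. -/
theorem exists_isVacuumState [Fintype ι] (η : ℂ) (u a d : ι → ℂ)
    (hu : ∀ p q, p ≠ q → sin (u p - u q) ≠ 0) :
    ∃ φ : YBAlgebra η u →ₗ[ℂ] ℂ, IsVacuumState η u a d φ := by
  classical
  have hinj : Function.Injective fun p => exp (I * u p) ^ 2 := by
    intro p q hpq
    by_contra hne
    apply hu p q hne
    have h : exp (I * u p) ^ 2 = exp (I * u q) ^ 2 := hpq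
    rw [sin, show -(u p - u q) * I = I * u q - I * u p by ring,
      show (u p - u q) * I = I * u p - I * u q by ring, exp_sub, exp_sub]
    have h1 := exp_ne_zero (I * u p)
    have h2 := exp_ne_zero (I * u q)
    field_simp
    rw [h]
    simp
  have heval : ∀ b : ι → ℂ, (fun p => (Lagrange.interpolate Finset.univ
      (fun p => exp (I * u p) ^ 2) b).eval (exp (I * u p) ^ 2)) = b := fun b => by
    funext p
    exact Lagrange.eval_interpolate_at_node b hinj.injOn (Finset.mem_univ p)
  have := isVacuumPair_polynomial η u
    (Lagrange.interpolate Finset.univ (fun p => exp (I * u p) ^ 2) a)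
    (Lagrange.interpolate Finset.univ (fun p => exp (I * u p) ^ 2) d)
  rwa [heval, heval] at this

end Existence

end XXZ

namespace XXZ

open Complex Filter Topology

/-! ### Functions that are analytic up to the value at a point -/

section Regular

/-- `F` agrees with a function analytic at `v` on a punctured neighbourhood of `v`. -/
def RegularAt (F : ℂ → ℂ) (v : ℂ) : Prop :=
  ∃ h : ℂ → ℂ, AnalyticAt ℂ h v ∧ ∀ᶠ x in 𝓝[≠] v, F x = h x

variable {F G : ℂ → ℂ} {v : ℂ}

theorem _root_.AnalyticAt.regularAt (h : AnalyticAt ℂ F v) : RegularAt F v :=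
  ⟨F, h, Eventually.of_forall fun _ => rfl⟩

theorem regularAt_const (c : ℂ) : RegularAt (fun _ => c) v :=
  analyticAt_const.regularAt

theorem RegularAt.add (hF : RegularAt F v) (hG : RegularAt G v) :
    RegularAt (fun x => F x + G x) v := by
  obtain ⟨f, hf, hf'⟩ := hF
  obtain ⟨g, hg, hg'⟩ := hG
  exact ⟨fun x => f x + g x, hf.add hg, by filter_upwards [hf', hg'] with x h1 h2; rw [h1, h2]⟩

theorem RegularAt.mul (hF : RegularAt F v) (hG : RegularAt G v) :
    RegularAt (fun x => F x * G x) v := by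
  obtain ⟨f, hf, hf'⟩ := hF
  obtain ⟨g, hg, hg'⟩ := hG
  exact ⟨fun x => f x * g x, hf.mul hg, by filter_upwards [hf', hg'] with x h1 h2; rw [h1, h2]⟩

theorem RegularAt.const_mul (c : ℂ) (hF : RegularAt F v) : RegularAt (fun x => c * F x) v :=
  (regularAt_const c).mul hF

theorem RegularAt.sub (hF : RegularAt F v) (hG : RegularAt G v) :
    RegularAt (fun x => F x - G x) v := by
  simpa only [sub_eq_add_neg, neg_one_mul] using hF.add (hG.const_mul (-1))

theorem RegularAt.congr (hF : RegularAt F v) (h : ∀ᶠ x in 𝓝[≠] v, G x = F x) :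
    RegularAt G v := by
  obtain ⟨f, hf, hf'⟩ := hF
  exact ⟨f, hf, by filter_upwards [h, hf'] with x h1 h2; rw [h1, h2]⟩

/-- Solving `s x * G x = F x` for `G`. -/
theorem RegularAt.of_mul_eq {s : ℂ → ℂ} (hF : RegularAt F v) (hs : AnalyticAt ℂ s v)
    (hs0 : s v ≠ 0) (h : ∀ᶠ x in 𝓝[≠] v, s x * G x = F x) : RegularAt G v := by
  refine ((hs.inv hs0).regularAt.mul hF).congr ?_
  filter_upwards [h, (hs.continuousAt.eventually_ne hs0).filter_mono nhdsWithin_le_nhds]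
    with x h1 h2
  rw [← h1, Pi.inv_apply, inv_mul_cancel_left₀ h2]

theorem hasDerivAt_sin_sub (v : ℂ) : HasDerivAt (fun x => sin (x - v)) 1 v := by
  simpa using ((hasDerivAt_id v).sub_const v).csin

theorem eventually_sin_sub_ne_zero (v : ℂ) : ∀ᶠ x in 𝓝[≠] v, sin (x - v) ≠ 0 :=
  (hasDerivAt_sin_sub v).eventually_ne one_ne_zero

/-- The pole of `1 / sin` at `0` is simple with residue `1`. -/
theorem regularAt_inv_sin_sub_inv (v : ℂ) :
    RegularAt (fun x => (sin (x - v))⁻¹ - (x - v)⁻¹) v := by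
  have dslope_analytic : ∀ {g : ℂ → ℂ}, AnalyticAt ℂ g v → AnalyticAt ℂ (dslope g v) v := by
    rintro g ⟨p, hp⟩
    exact hp.has_fpower_series_dslope_fslope.analyticAt
  let S : ℂ → ℂ := dslope (fun x => sin (x - v)) v
  have hsin : AnalyticAt ℂ (fun x => sin (x - v)) v := by fun_prop
  have hS : AnalyticAt ℂ S v := dslope_analytic hsin
  have hS1 : S v = 1 := by
    simp only [S, dslope_same, (hasDerivAt_sin_sub v).deriv]
  have hS0 : S v ≠ 0 := by simp [hS1]
  refine ⟨_, dslope_analytic (hS.inv hS0), ?_⟩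
  filter_upwards [self_mem_nhdsWithin,
    (hS.continuousAt.eventually_ne hS0).filter_mono nhdsWithin_le_nhds] with x hx hSx
  have hxv : x - v ≠ 0 := sub_ne_zero.mpr hx
  have hx' : sin (x - v) = (x - v) * S x := by
    have := sub_smul_dslope (fun x => sin (x - v)) v x
    simp only [sub_self, sin_zero, sub_zero, smul_eq_mul] at this
    exact this.symm
  rw [dslope_of_ne _ hx, slope_def_field, hx', Pi.inv_apply, Pi.inv_apply, hS1]
  field_simp

end Regular

/-! ### The pole of the vacuum expectation values -/

section Pole

variable {ι : Type} {η v : ℂ} {u : ℂ → ι → ℂ} {a d : ι → ℂ}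
  {Φ : ℂ → List (ι × Fin 2 × Fin 2) → ℂ} {px pv : ι}

theorem map_fst_swap_perm {κ : Type} (w w' : List (κ × Fin 2 × Fin 2)) (p q : κ)
    (s t s' t' : Fin 2 × Fin 2) :
    ((w ++ (q, s) :: (p, t) :: w').map Prod.fst).Perm
      ((w ++ (p, s') :: (q, t') :: w').map Prod.fst) := by
  simpa using List.Perm.append_left _ (List.Perm.swap p q _)

/-- Words that do not contain both colliding points have no pole at the collision. -/
theorem regularAt_word (hΦ : ∀ᶠ x in 𝓝[≠] v, IsWordState η (u x) a d (Φ x))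
    (hu : ∀ p, AnalyticAt ℂ (fun x => u x p) v)
    (hne : ∀ p q, p ≠ q → ¬(p = px ∧ q = pv) → ¬(p = pv ∧ q = px) → sin (u v p - u v q) ≠ 0)
    (w : List (ι × Fin 2 × Fin 2)) (hw : (w.map Prod.fst).Nodup)
    (hxv : ¬(px ∈ w.map Prod.fst ∧ pv ∈ w.map Prod.fst)) :
    RegularAt (fun x => Φ x w) v := by
  have hsin : ∀ p q, AnalyticAt ℂ (fun x => sin (u x p - u x q)) v := fun p q => by
    have := hu p
    have := hu q
    fun_prop
  have hsin' : ∀ p q, RegularAt (fun x => sin (u x p - u x q + I * η)) v := fun p q => by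
    have := hu p
    have := hu q
    exact AnalyticAt.regularAt (by fun_prop)
  refine word_induction (P := fun w => ¬(px ∈ w.map Prod.fst ∧ pv ∈ w.map Prod.fst) →
    RegularAt (fun x => Φ x w) v) ?_ ?_ ?_ ?_ ?_ ?_ ?_ ?_ w hw hxv
  · intro _
    exact (regularAt_const 1).congr (hΦ.mono fun x h => h.nil)
  · intro w p _ ih hb
    exact ((ih fun h => hb (by simp [h.1, h.2])).const_mul (a p)).congr
      (hΦ.mono fun x h => h.append_A w p)
  · intro w p _ ih hb
    exact ((ih fun h => hb (by simp [h.1, h.2])).const_mul (d p)).congr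
      (hΦ.mono fun x h => h.append_D w p)
  · intro w p _ _
    exact (regularAt_const 0).congr (hΦ.mono fun x h => h.append_C w p)
  · intro w p _ _
    exact (regularAt_const 0).congr (hΦ.mono fun x h => h.cons_B w p)
  · intro w w' p q hpq h1 h2 hb
    refine RegularAt.of_mul_eq (((hsin' q p).mul (h1 fun h => hb ?_)).sub
      ((h2 fun h => hb ?_).const_mul (sin (I * η)))) (hsin q p) (hne q p hpq.symm ?_ ?_)
      (hΦ.mono fun x h => h.A_B w w' p q)
    · exact h.imp (map_fst_swap_perm _ _ _ _ _ _ _ _).mem_iff.1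
        (map_fst_swap_perm _ _ _ _ _ _ _ _).mem_iff.1
    · simpa using h
    · rintro ⟨rfl, rfl⟩; exact hb (by simp)
    · rintro ⟨rfl, rfl⟩; exact hb (by simp)
  · intro w w' p q hpq h1 h2 hb
    refine RegularAt.of_mul_eq (((hsin' p q).mul (h1 fun h => hb ?_)).sub
      ((h2 fun h => hb ?_).const_mul (sin (I * η)))) (hsin p q) (hne p q hpq ?_ ?_)
      (hΦ.mono fun x h => h.D_B w w' p q)
    · exact h.imp (map_fst_swap_perm _ _ _ _ _ _ _ _).mem_iff.1
        (map_fst_swap_perm _ _ _ _ _ _ _ _).mem_iff.1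
    · simpa using h
    · rintro ⟨rfl, rfl⟩; exact hb (by simp)
    · rintro ⟨rfl, rfl⟩; exact hb (by simp)
  · intro w w' p q hpq h1 h2 h3 hb
    refine RegularAt.of_mul_eq (((hsin q p).regularAt.mul (h1 fun h => hb ?_)).add
      (((h2 fun h => hb ?_).sub (h3 fun h => hb ?_)).const_mul (sin (I * η)))) (hsin q p)
      (hne q p hpq.symm ?_ ?_) (hΦ.mono fun x h => h.C_B w w' p q)
    · exact h.imp (map_fst_swap_perm _ _ _ _ _ _ _ _).mem_iff.1
        (map_fst_swap_perm _ _ _ _ _ _ _ _).mem_iff.1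
    · exact h.imp (map_fst_swap_perm _ _ _ _ _ _ _ _).mem_iff.1
        (map_fst_swap_perm _ _ _ _ _ _ _ _).mem_iff.1
    · simpa using h
    · rintro ⟨rfl, rfl⟩; exact hb (by simp)
    · rintro ⟨rfl, rfl⟩; exact hb (by simp)

/-- The residue of `⟨0|C(x) w B(v)|0⟩` at `x = v` is, as a function of the word `w`, a multiple of
the vacuum expectation value `ψ` with modified eigenvalues. Here `px` and `pv` are the points with
rapidities `x` and `v`, and `w` is a word in the other points `e p`, with rapidities `y p`. -/
theorem regularAt_sub_pole {κ : Type} {e : κ → ι} {y : κ → ℂ}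
    {ψ : List (κ × Fin 2 × Fin 2) → ℂ}
    (hΦ : ∀ᶠ x in 𝓝[≠] v, IsWordState η (u x) a d (Φ x))
    (he : Function.Injective e) (hx : ∀ p, e p ≠ px) (hv : ∀ p, e p ≠ pv) (hxv : px ≠ pv)
    (ux : ∀ x, u x px = x) (uv : ∀ x, u x pv = v) (ue : ∀ x p, u x (e p) = y p)
    (hy : ∀ p q, p ≠ q → sin (y p - y q) ≠ 0) (hyv : ∀ p, sin (y p - v) ≠ 0)
    (hι : ∀ p, p = px ∨ p = pv ∨ p ∈ Set.range e)
    (hψ : IsWordState η y (fun p => a (e p) * f η v (y p)) (fun p => d (e p) * f η (y p) v) ψ)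
    (w : List (κ × Fin 2 × Fin 2)) (hw : (w.map Prod.fst).Nodup) :
    RegularAt (fun x => Φ x ((px, 1, 0) :: (w.map (Prod.map e id) ++ [(pv, 0, 1)])) -
      sin (I * η) * (a pv * d px - a px * d pv) * ψ w * (x - v)⁻¹) v := by
  have hvy : ∀ p, sin (v - y p) ≠ 0 := fun p h => hyv p (by rw [← neg_sub, sin_neg, h, neg_zero])
  have hu : ∀ p, AnalyticAt ℂ (fun x => u x p) v := by
    intro p
    rcases hι p with rfl | rfl | ⟨q, rfl⟩
    · simp only [ux]
      exact analyticAt_id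
    · simp only [uv]
      exact analyticAt_const
    · simp only [ue]
      exact analyticAt_const
  have hne : ∀ p q, p ≠ q → ¬(p = px ∧ q = pv) → ¬(p = pv ∧ q = px) →
      sin (u v p - u v q) ≠ 0 := by
    intro p q hpq h1 h2
    rcases hι p with rfl | rfl | ⟨p, rfl⟩ <;> rcases hι q with rfl | rfl | ⟨q, rfl⟩ <;>
      simp only [ux, uv, ue]
    · exact absurd rfl hpq
    · exact absurd ⟨rfl, rfl⟩ h1
    · exact hvy q
    · exact absurd ⟨rfl, rfl⟩ h2
    · exact absurd rfl hpq
    · exact hvy q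
    · exact hyv p
    · exact hyv p
    · exact hy p q fun h => hpq (by rw [h])
  have reg := regularAt_word hΦ hu hne
  have hnx : ∀ l : List κ, px ∉ l.map e := fun l h => by
    obtain ⟨p, -, hp⟩ := List.mem_map.mp h
    exact hx p hp
  have hnv : ∀ l : List κ, pv ∉ l.map e := fun l h => by
    obtain ⟨p, -, hp⟩ := List.mem_map.mp h
    exact hv p hp
  have hreg : ∀ (w : List (κ × Fin 2 × Fin 2)) (p : κ), (w.map Prod.fst ++ [p]).Nodup →
      RegularAt (fun x => Φ x ((px, 1, 0) :: (w.map (Prod.map e id) ++ [(e p, 0, 1)]))) v := by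
    intro w p hnd
    have hl : ((px, (1 : Fin 2), (0 : Fin 2)) ::
        (w.map (Prod.map e id) ++ [(e p, (0 : Fin 2), (1 : Fin 2))])).map Prod.fst =
        px :: (w.map Prod.fst ++ [p]).map e := by simp
    refine reg _ ?_ ?_ <;> rw [hl]
    · exact List.nodup_cons.mpr ⟨hnx _, hnd.map he⟩
    · exact fun h => (List.mem_cons.mp h.2).elim (fun h => hxv h.symm) (hnv _)
  refine word_induction (P := fun w => RegularAt (fun x =>
    Φ x ((px, 1, 0) :: (w.map (Prod.map e id) ++ [(pv, 0, 1)])) -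
      sin (I * η) * (a pv * d px - a px * d pv) * ψ w * (x - v)⁻¹) v) ?_ ?_ ?_ ?_ ?_ ?_ ?_ ?_ w hw
  · -- the empty word: `C_B` leaves the determinant of the eigenvalues over `sin (x - v)`
    refine ((regularAt_inv_sin_sub_inv v).const_mul
      (sin (I * η) * (a pv * d px - a px * d pv))).congr ?_
    filter_upwards [hΦ, eventually_sin_sub_ne_zero v] with x h hs
    have h1 := h.C_B [] [] px pv
    simp only [List.nil_append, ux, uv, h.cons_B, h.cons_D] at h1
    have h2 := h.append_A [] px
    have h3 := h.append_A [] pv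
    simp only [List.nil_append, h.nil] at h2 h3
    rw [h2, h3, ← neg_sub x v, sin_neg] at h1
    simp only [List.map_nil, List.nil_append, hψ.nil]
    field_simp at h1 ⊢
    linear_combination -h1
  · -- `A(p)` moved through `B(v)` picks up `f(v, p)`; the other term, with `B(p)` and `A(v)`
    -- exchanged, is regular
    intro w p hnd ih
    refine ((ih.const_mul (a (e p) * f η v (y p))).sub
      ((hreg w p hnd).const_mul (sin (I * η) / sin (v - y p) * a pv))).congr ?_
    filter_upwards [hΦ] with x h
    have h1 := h.A_B ((px, 1, 0) :: w.map (Prod.map e id)) [] (e p) pv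
    have h2 := h.append_A ((px, 1, 0) :: w.map (Prod.map e id) ++ [(pv, 0, 1)]) (e p)
    have h3 := h.append_A ((px, 1, 0) :: w.map (Prod.map e id) ++ [(e p, 0, 1)]) pv
    simp only [List.cons_append, List.append_assoc, List.nil_append, uv, ue] at h1 h2 h3
    rw [h2, h3] at h1
    simp only [List.map_append, List.map_cons, List.map_nil, Prod.map, id, List.append_assoc,
      List.cons_append, List.nil_append, hψ.append_A, f]
    have := hvy p
    field_simp
    linear_combination h1
  · intro w p hnd ih
    refine ((ih.const_mul (d (e p) * f η (y p) v)).sub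
      ((hreg w p hnd).const_mul (sin (I * η) / sin (y p - v) * d pv))).congr ?_
    filter_upwards [hΦ] with x h
    have h1 := h.D_B ((px, 1, 0) :: w.map (Prod.map e id)) [] (e p) pv
    have h2 := h.append_D ((px, 1, 0) :: w.map (Prod.map e id) ++ [(pv, 0, 1)]) (e p)
    have h3 := h.append_D ((px, 1, 0) :: w.map (Prod.map e id) ++ [(e p, 0, 1)]) pv
    simp only [List.cons_append, List.append_assoc, List.nil_append, uv, ue] at h1 h2 h3
    rw [h2, h3] at h1
    simp only [List.map_append, List.map_cons, List.map_nil, Prod.map, id, List.append_assoc,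
      List.cons_append, List.nil_append, hψ.append_D, f]
    have := hyv p
    field_simp
    linear_combination h1
  · -- `C(p)` moved through `B(v)` kills the vacuum; the other terms contain `x` but not `v`
    intro w p hnd
    have hreg : RegularAt (fun x => Φ x ((px, 1, 0) :: w.map (Prod.map e id))) v := by
      have hl : ((px, (1 : Fin 2), (0 : Fin 2)) :: w.map (Prod.map e id)).map Prod.fst =
          px :: (w.map Prod.fst).map e := by simp
      refine reg _ ?_ ?_ <;> rw [hl]
      · exact List.nodup_cons.mpr ⟨hnx _, hnd.of_append_left.map he⟩
      · exact fun h => (List.mem_cons.mp h.2).elim (fun h => hxv h.symm) (hnv _)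
    refine (hreg.const_mul (sin (I * η) * (a (e p) * d pv - a pv * d (e p)) /
      sin (v - y p))).congr ?_
    filter_upwards [hΦ] with x h
    have h1 := h.C_B ((px, 1, 0) :: w.map (Prod.map e id)) [] (e p) pv
    have h2 := h.append_C ((px, 1, 0) :: w.map (Prod.map e id) ++ [(pv, 0, 1)]) (e p)
    have h3 := h.append_A ((px, 1, 0) :: w.map (Prod.map e id) ++ [(pv, 1, 1)]) (e p)
    have h4 := h.append_A ((px, 1, 0) :: w.map (Prod.map e id) ++ [(e p, 1, 1)]) pv
    rw [h.append_D] at h3 h4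
    simp only [List.cons_append, List.append_assoc, List.nil_append, uv, ue] at h1 h2 h3 h4
    rw [h2, h3, h4] at h1
    simp only [List.map_append, List.map_cons, List.map_nil, Prod.map, id, List.append_assoc,
      List.cons_append, List.nil_append, hψ.append_C]
    have := hvy p
    field_simp
    linear_combination h1
  · -- `B(p)` moved through `C(x)` kills the dual vacuum; the other terms are regular
    intro w p hnd
    have hreg : RegularAt (fun x => Φ x (w.map (Prod.map e id) ++ [(pv, 0, 1)])) v := by
      have hl : (w.map (Prod.map e id) ++ [(pv, (0 : Fin 2), (1 : Fin 2))]).map Prod.fst =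
          (w.map Prod.fst).map e ++ [pv] := by simp
      refine reg _ ?_ ?_ <;> rw [hl]
      · exact List.nodup_append_comm.mp
          (List.nodup_cons.mpr ⟨hnv _, (List.nodup_cons.mp hnd).2.map he⟩)
      · exact fun h => (List.mem_append.mp h.1).elim (hnx _) fun h => hxv (List.mem_singleton.mp h)
    refine RegularAt.congr (RegularAt.of_mul_eq (s := fun x => sin (y p - x))
      (hreg.const_mul (sin (I * η) * (d (e p) * a px - d px * a (e p)))) (by fun_prop) (hyv p)
      (G := fun x => Φ x ((px, 1, 0) :: (e p, 0, 1) ::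
        (w.map (Prod.map e id) ++ [(pv, 0, 1)]))) ?_) ?_
    · filter_upwards [hΦ] with x h
      have h1 := h.C_B [] (w.map (Prod.map e id) ++ [(pv, 0, 1)]) px (e p)
      simp only [List.nil_append, ux, ue, h.cons_B, h.cons_D, h.cons_A] at h1
      rw [h1]
      ring
    · exact Eventually.of_forall fun x => by simp [hψ.cons_B]
  -- exchanges inside `w` hold with the same coefficients, independent of `x`, for `Φ x` and `ψ`
  · intro w w' p q hpq h1 h2
    refine (((h1.const_mul (sin (y q - y p + I * η))).sub (h2.const_mul (sin (I * η)))).const_mul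
      (sin (y q - y p))⁻¹).congr ?_
    filter_upwards [hΦ] with x h
    have h1 := h.A_B ((px, 1, 0) :: w.map (Prod.map e id))
      (w'.map (Prod.map e id) ++ [(pv, 0, 1)]) (e p) (e q)
    have h2 := hψ.A_B w w' p q
    have := hy q p hpq.symm
    simp only [List.map_append, List.map_cons, Prod.map, id, List.append_assoc,
      List.cons_append, ue] at h1 ⊢
    rw [eq_inv_mul_iff_mul_eq₀ this]
    linear_combination h1 - sin (I * η) * (a pv * d px - a px * d pv) * (x - v)⁻¹ * h2
  · intro w w' p q hpq h1 h2
    refine (((h1.const_mul (sin (y p - y q + I * η))).sub (h2.const_mul (sin (I * η)))).const_mul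
      (sin (y p - y q))⁻¹).congr ?_
    filter_upwards [hΦ] with x h
    have h1 := h.D_B ((px, 1, 0) :: w.map (Prod.map e id))
      (w'.map (Prod.map e id) ++ [(pv, 0, 1)]) (e p) (e q)
    have h2 := hψ.D_B w w' p q
    have := hy p q hpq
    simp only [List.map_append, List.map_cons, Prod.map, id, List.append_assoc,
      List.cons_append, ue] at h1 ⊢
    rw [eq_inv_mul_iff_mul_eq₀ this]
    linear_combination h1 - sin (I * η) * (a pv * d px - a px * d pv) * (x - v)⁻¹ * h2
  · intro w w' p q hpq h1 h2 h3
    refine (((h1.const_mul (sin (y q - y p))).add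
      ((h2.sub h3).const_mul (sin (I * η)))).const_mul (sin (y q - y p))⁻¹).congr ?_
    filter_upwards [hΦ] with x h
    have h1 := h.C_B ((px, 1, 0) :: w.map (Prod.map e id))
      (w'.map (Prod.map e id) ++ [(pv, 0, 1)]) (e p) (e q)
    have h2 := hψ.C_B w w' p q
    have := hy q p hpq.symm
    simp only [List.map_append, List.map_cons, Prod.map, id, List.append_assoc,
      List.cons_append, ue] at h1 ⊢
    rw [eq_inv_mul_iff_mul_eq₀ this]
    linear_combination h1 - sin (I * η) * (a pv * d px - a px * d pv) * (x - v)⁻¹ * h2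

end Pole

end XXZ

namespace XXZ

open Complex Filter Topology

/-! ### Matrix elements -/

section MatrixElements

variable {N M : ℕ}

/-- The word of `∏ C(λ^C) · X₁(μ₁) ⋯ X_M(μ_M) · ∏ B(λ^B)`. -/
def letters (N : ℕ) {M : ℕ} (X : Fin M → Fin 2 × Fin 2) :
    List ((Fin N ⊕ Fin N ⊕ Fin M) × Fin 2 × Fin 2) :=
  (List.ofFn fun j : Fin N => (Sum.inl j, 1, 0)) ++
    ((List.ofFn fun k : Fin M => (Sum.inr (Sum.inr k), X k)) ++
      (List.ofFn fun j : Fin N => (Sum.inr (Sum.inl j), 0, 1)))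

theorem nodup_letters (N : ℕ) (X : Fin M → Fin 2 × Fin 2) :
    ((letters N X).map Prod.fst).Nodup := by
  simp only [letters, List.map_append, List.map_ofFn, Function.comp_def]
  refine List.Nodup.append ?_ (List.Nodup.append ?_ ?_ ?_) ?_
  · exact List.nodup_ofFn.mpr fun i j h => by simpa using h
  · exact List.nodup_ofFn.mpr fun i j h => by simpa using h
  · exact List.nodup_ofFn.mpr fun i j h => by simpa using h
  · intro p h1 h2
    simp only [List.mem_ofFn] at h1 h2
    obtain ⟨i, rfl⟩ := h1
    obtain ⟨j, hj⟩ := h2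
    simp at hj
  · intro p h1 h2
    simp only [List.mem_append, List.mem_ofFn] at h1 h2
    obtain ⟨i, rfl⟩ := h1
    rcases h2 with ⟨j, hj⟩ | ⟨j, hj⟩ <;> simp at hj

theorem prod_ofFn_smul {S : Type*} [Semiring S] [Algebra ℂ S] {n : ℕ} (k : Fin n → ℂ)
    (x : Fin n → S) :
    (List.ofFn fun j => k j • x j).prod = (∏ j, k j) • (List.ofFn x).prod := by
  induction n with
  | zero => simp
  | succ n ih =>
    simp only [List.ofFn_succ, List.prod_cons, Fin.prod_univ_succ,
      ih (fun j => k j.succ) (fun j => x j.succ), smul_mul_smul_comm]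

theorem word_eq_smul_monomial (η : ℂ) (c b : Fin N → SpectralPoint) (X : Fin M → Fin 2 × Fin 2)
    (o : Fin M → SpectralPoint) :
    word η c b X o =
      ((∏ j, (c j).d⁻¹) * ∏ j, (b j).d⁻¹) • monomial η (raps c b o) (letters N X) := by
  simp only [word, monomial, letters, prod_ofFn_smul, List.map_append, List.map_ofFn,
    Function.comp_def, List.prod_append, smul_mul_assoc, mul_smul_comm, smul_smul, mul_assoc, C, B,
    mul_comm (∏ j, (b j).d⁻¹)]

theorem exists_isVacuumStateAt (η : ℂ) {c b : Fin N → SpectralPoint} {o : Fin M → SpectralPoint}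
    (h : Generic (points c b o)) : ∃ φ, IsVacuumStateAt η c b o φ :=
  exists_isVacuumState η _ _ _ h

theorem exists_isWordState (η : ℂ) {c b : Fin N → SpectralPoint} {o : Fin M → SpectralPoint}
    (h : Generic (points c b o)) :
    ∃ Φ, IsWordState η (raps c b o) (fun p => (points c b o p).a) (fun p => (points c b o p).d) Φ :=
  let ⟨_, hφ⟩ := exists_isVacuumStateAt η h
  ⟨_, IsVacuumState.isWordState hφ⟩

theorem matrixElement_eq (η : ℂ) {c b : Fin N → SpectralPoint} (X : Fin M → Fin 2 × Fin 2)
    {o : Fin M → SpectralPoint} (h : Generic (points c b o))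
    {Φ : List ((Fin N ⊕ Fin N ⊕ Fin M) × Fin 2 × Fin 2) → ℂ}
    (hΦ : IsWordState η (raps c b o) (fun p => (points c b o p).a) (fun p => (points c b o p).d) Φ) :
    matrixElement η c b X o =
      ((∏ j, (c j).d⁻¹) * ∏ j, (b j).d⁻¹) * Φ (letters N X) := by
  have hex := exists_isVacuumStateAt η h
  have hψ : IsVacuumStateAt η c b o hex.choose := hex.choose_spec
  have := hΦ.eq_prod_mul (κ := 1) h hψ.isWordState (by simp) (by simp) (letters N X)
    (nodup_letters N X)
  simp only [Pi.one_apply, List.map_const', List.prod_replicate, one_pow, one_mul] at this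
  rw [matrixElement, vev]
  refine (dif_pos hex).trans ?_
  rw [word_eq_smul_monomial, map_smul, smul_eq_mul]
  exact congrArg _ this

/-- Uniqueness of the vacuum expectation value on the word of a matrix element. -/
theorem IsVacuumStateAt.apply_word {η : ℂ} {c b : Fin N → SpectralPoint}
    {o : Fin M → SpectralPoint} {φ : YBAlgebra η (raps c b o) →ₗ[ℂ] ℂ}
    (hφ : IsVacuumStateAt η c b o φ) (h : Generic (points c b o)) (X : Fin M → Fin 2 × Fin 2) :
    φ (word η c b X o) = matrixElement η c b X o := by
  rw [matrixElement_eq η X h (IsVacuumState.isWordState hφ), word_eq_smul_monomial, map_smul,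
    smul_eq_mul]

theorem matrixElement_congr (η : ℂ) {c b c' b' : Fin N → SpectralPoint}
    (X : Fin M → Fin 2 × Fin 2) {o : Fin M → SpectralPoint} (h : Generic (points c b o))
    (hc : ∀ j, (c j).d ≠ 0 ∧ (c' j).d ≠ 0 ∧ (c' j).rap = (c j).rap ∧ (c' j).l = (c j).l)
    (hb : ∀ j, (b j).d ≠ 0 ∧ (b' j).d ≠ 0 ∧ (b' j).rap = (b j).rap ∧ (b' j).l = (b j).l) :
    matrixElement η c' b' X o = matrixElement η c b X o := by
  have hraps : raps c' b' o = raps c b o := by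
    funext p
    rcases p with j | j | k
    · exact (hc j).2.2.1
    · exact (hb j).2.2.1
    · rfl
  have h' : Generic (points c' b' o) := fun p q hpq => by
    have := h p q hpq
    have hp := congrFun hraps p
    have hq := congrFun hraps q
    simp only [raps] at hp hq
    rwa [hp, hq]
  obtain ⟨Φ, w⟩ := exists_isWordState η h
  obtain ⟨Φ', w'⟩ := exists_isWordState η h'
  rw [matrixElement_eq η X h w, matrixElement_eq η X h' w']
  rw [hraps] at w'
  -- the factors by which the eigenvalues change, common to `a` and `d`
  let κ : Fin N ⊕ Fin N ⊕ Fin M → ℂ :=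
    Sum.elim (fun j => (c' j).d / (c j).d) (Sum.elim (fun j => (b' j).d / (b j).d) 1)
  have ha : ∀ s s' : SpectralPoint, s.d ≠ 0 → s'.d ≠ 0 → s'.l = s.l → s'.a = s'.d / s.d * s.a := by
    intro s s' h h' hl
    simp only [SpectralPoint.l] at hl
    field_simp at hl ⊢
    linear_combination hl
  have key := w.eq_prod_mul (κ := κ) h w' ?_ ?_ (letters N X) (nodup_letters N X)
  · have hκ : ((letters N X).map fun t => κ t.1).prod =
        (∏ j, (c' j).d / (c j).d) * ∏ j, (b' j).d / (b j).d := by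
      simp [letters, κ, Function.comp_def, List.prod_ofFn]
    rw [hκ] at key
    refine (congrArg _ key).trans ?_
    have h1 : ∏ j, (c j).d ≠ 0 := Finset.prod_ne_zero_iff.mpr fun j _ => (hc j).1
    have h2 : ∏ j, (c' j).d ≠ 0 := Finset.prod_ne_zero_iff.mpr fun j _ => (hc j).2.1
    have h3 : ∏ j, (b j).d ≠ 0 := Finset.prod_ne_zero_iff.mpr fun j _ => (hb j).1
    have h4 : ∏ j, (b' j).d ≠ 0 := Finset.prod_ne_zero_iff.mpr fun j _ => (hb j).2.1
    simp only [Finset.prod_div_distrib, Finset.prod_inv_distrib]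
    field_simp
  · rintro (j | j | k)
    · exact ha _ _ (hc j).1 (hc j).2.1 (hc j).2.2.2
    · exact ha _ _ (hb j).1 (hb j).2.1 (hb j).2.2.2
    · simp [κ, points]
  · rintro (j | j | k)
    · exact (div_mul_cancel₀ _ (hc j).1).symm
    · exact (div_mul_cancel₀ _ (hb j).1).symm
    · simp [κ, points]

/-- The operators `C` commute, so the last of several can be moved to the front. -/
theorem IsWordState.append_map_C_cons {ι : Type} {η : ℂ} {u a d : ι → ℂ}
    {Φ : List (ι × Fin 2 × Fin 2) → ℂ} (h : IsWordState η u a d Φ) (p : ι) (l : List ι)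
    (hl : ∀ q ∈ l, sin (u q - u p + I * η) ≠ 0) (w w' : List (ι × Fin 2 × Fin 2)) :
    Φ (w ++ (l.map (fun q => (q, 1, 0)) ++ (p, 1, 0) :: w')) =
      Φ (w ++ (p, 1, 0) :: (l.map (fun q => (q, 1, 0)) ++ w')) := by
  induction l generalizing w with
  | nil => rfl
  | cons q l ih =>
    have h1 := ih (fun r hr => hl r (List.mem_cons_of_mem _ hr)) (w ++ [(q, 1, 0)])
    have h2 := mul_left_cancel₀ (hl q List.mem_cons_self)
      (h.C_C w (l.map (fun q => (q, 1, 0)) ++ w') p q)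
    simp only [List.append_assoc, List.cons_append, List.nil_append, List.map_cons] at h1 ⊢
    rw [h1, h2]

/-- The points of an `N`-particle matrix element inside those of the `(N+1)`-particle one. -/
def castPoint (N M : ℕ) : Fin N ⊕ Fin N ⊕ Fin M → Fin (N + 1) ⊕ Fin (N + 1) ⊕ Fin M :=
  Sum.map Fin.castSucc (Sum.map Fin.castSucc id)

theorem letters_succ (N : ℕ) (X : Fin M → Fin 2 × Fin 2) :
    letters (N + 1) X = ((List.ofFn fun j : Fin N => Sum.inl j.castSucc).map fun q => (q, 1, 0)) ++
      (Sum.inl (Fin.last N), 1, 0) ::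
        ((List.ofFn fun k : Fin M => (Sum.inr (Sum.inr k), X k)) ++
          ((List.ofFn fun j : Fin N => (Sum.inr (Sum.inl j.castSucc), 0, 1)) ++
            [(Sum.inr (Sum.inl (Fin.last N)), 0, 1)])) := by
  simp only [letters, List.ofFn_succ', List.concat_eq_append, List.map_ofFn, Function.comp_def,
    List.append_assoc, List.cons_append, List.nil_append]

theorem map_castPoint_letters (N : ℕ) (X : Fin M → Fin 2 × Fin 2) :
    (letters N X).map (Prod.map (castPoint N M) id) =
      ((List.ofFn fun j : Fin N => Sum.inl j.castSucc).map fun q => (q, 1, 0)) ++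
        ((List.ofFn fun k : Fin M => (Sum.inr (Sum.inr k), X k)) ++
          (List.ofFn fun j : Fin N => (Sum.inr (Sum.inl j.castSucc), 0, 1))) := by
  simp [letters, castPoint, Function.comp_def]

/-- The singularity property: the matrix element minus its asserted pole is analytic at `v`, up to
its value there. -/
theorem singularity (η : ℂ) (c b : Fin N → SpectralPoint) (X : Fin M → Fin 2 × Fin 2)
    (o : Fin M → SpectralPoint) (v aC dC aB dB : ℂ) (hdC : dC ≠ 0) (hdB : dB ≠ 0)
    (hgen : Generic (Sum.elim (fun _ : Unit => (⟨v, aB, dB⟩ : SpectralPoint)) (points c b o)))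
    (hfc : ∀ k, f η (c k).rap v ≠ 0) (hfb : ∀ k, f η (b k).rap v ≠ 0) :
    RegularAt (fun x =>
      matrixElement η (Fin.snoc (α := fun _ => SpectralPoint) c ⟨x, aC, dC⟩)
        (Fin.snoc (α := fun _ => SpectralPoint) b ⟨v, aB, dB⟩) X o -
      (I * sinh η * (aB / dB - aC / dC) * (∏ k, f η (c k).rap v * f η (b k).rap v) *
        matrixElement η (fun k => (c k).modify η v) (fun k => (b k).modify η v) X
          (fun k => (o k).modify η v)) / (x - v)) v := by
  set cx : ℂ → Fin (N + 1) → SpectralPoint := fun x =>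
    Fin.snoc (α := fun _ => SpectralPoint) c ⟨x, aC, dC⟩ with hcx
  set bv : Fin (N + 1) → SpectralPoint :=
    Fin.snoc (α := fun _ => SpectralPoint) b ⟨v, aB, dB⟩ with hbv
  let e := castPoint N M
  have he : Function.Injective e :=
    (Fin.castSucc_injective N).sumMap ((Fin.castSucc_injective N).sumMap Function.injective_id)
  let px : Fin (N + 1) ⊕ Fin (N + 1) ⊕ Fin M := Sum.inl (Fin.last N)
  let pv : Fin (N + 1) ⊕ Fin (N + 1) ⊕ Fin M := Sum.inr (Sum.inl (Fin.last N))
  have hx : ∀ p, e p ≠ px := by rintro (j | j | k) <;> simp [e, px, castPoint, Fin.castSucc_ne_last]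
  have hv : ∀ p, e p ≠ pv := by rintro (j | j | k) <;> simp [e, pv, castPoint, Fin.castSucc_ne_last]
  have hxv : px ≠ pv := by simp [px, pv]
  have hι : ∀ p, p = px ∨ p = pv ∨ p ∈ Set.range e := by
    rintro (j | j | k)
    · induction j using Fin.lastCases with
      | last => exact Or.inl rfl
      | cast j => exact Or.inr (Or.inr ⟨Sum.inl j, rfl⟩)
    · induction j using Fin.lastCases with
      | last => exact Or.inr (Or.inl rfl)
      | cast j => exact Or.inr (Or.inr ⟨Sum.inr (Sum.inl j), rfl⟩)
    · exact Or.inr (Or.inr ⟨Sum.inr (Sum.inr k), rfl⟩)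
  have px_eq : ∀ x, points (cx x) bv o px = ⟨x, aC, dC⟩ := fun x => by simp [points, px, cx]
  have pv_eq : ∀ x, points (cx x) bv o pv = ⟨v, aB, dB⟩ := fun x => by simp [points, pv, bv]
  have pe_eq : ∀ x p, points (cx x) bv o (e p) = points c b o p := by
    rintro x (j | j | k) <;> simp [points, e, castPoint, cx, bv]
  have hy : Generic (points c b o) := fun p q hpq => hgen (Sum.inr p) (Sum.inr q) (by simpa)
  have hyv : ∀ p, sin ((points c b o p).rap - v) ≠ 0 := fun p =>
    hgen (Sum.inr p) (Sum.inl ()) (by simp)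
  have hgenx : ∀ᶠ x in 𝓝[≠] v, Generic (points (cx x) bv o) := by
    have h1 : ∀ᶠ x in 𝓝[≠] v, ∀ p, sin ((points c b o p).rap - x) ≠ 0 := by
      refine Filter.eventually_all.mpr fun p => Filter.Eventually.filter_mono nhdsWithin_le_nhds ?_
      exact ContinuousAt.eventually_ne (by fun_prop) (hyv p)
    have hneg : ∀ s t : ℂ, sin (s - t) ≠ 0 → sin (t - s) ≠ 0 := fun s t h h' =>
      h (by rw [← neg_sub, sin_neg, h', neg_zero])
    filter_upwards [h1, eventually_sin_sub_ne_zero v] with x h1 h2 p q hpq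
    rcases hι p with rfl | rfl | ⟨p, rfl⟩ <;> rcases hι q with rfl | rfl | ⟨q, rfl⟩ <;>
      simp only [px_eq, pv_eq, pe_eq]
    · exact absurd rfl hpq
    · exact h2
    · exact hneg _ _ (h1 q)
    · exact hneg _ _ h2
    · exact absurd rfl hpq
    · exact hneg _ _ (hyv q)
    · exact h1 p
    · exact hyv p
    · exact hy p q fun h => hpq (by rw [h])
  -- `f(λ_k^C, v) ≠ 0` is what lets `C(x)` commute with the other `C`s for `x` near `v`
  have hcomm : ∀ᶠ x in 𝓝[≠] v, ∀ k, sin ((c k).rap - x + I * η) ≠ 0 := by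
    refine Filter.eventually_all.mpr fun k => Filter.Eventually.filter_mono nhdsWithin_le_nhds ?_
    refine ContinuousAt.eventually_ne (by fun_prop) fun h => hfc k ?_
    simp [f, h]
  -- a family of vacuum states, arbitrary where the rapidities are not generic
  have hex : ∀ x, ∃ Φ, Generic (points (cx x) bv o) → IsWordState η (raps (cx x) bv o)
      (fun p => (points (cx x) bv o p).a) (fun p => (points (cx x) bv o p).d) Φ := by
    intro x
    by_cases h : Generic (points (cx x) bv o)
    · obtain ⟨Φ, hΦ⟩ := exists_isWordState η h
      exact ⟨Φ, fun _ => hΦ⟩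
    · exact ⟨0, fun h' => absurd h' h⟩
  choose Φ hΦ using hex
  -- the vacuum eigenvalues do not depend on `x`
  have hconst : ∀ x p, (points (cx x) bv o p).a = (points (cx v) bv o p).a ∧
      (points (cx x) bv o p).d = (points (cx v) bv o p).d := fun x p => by
    rcases hι p with rfl | rfl | ⟨p, rfl⟩ <;> simp only [px_eq, pv_eq, pe_eq, and_self]
  have hΦv : ∀ᶠ x in 𝓝[≠] v, IsWordState η (raps (cx x) bv o)
      (fun p => (points (cx v) bv o p).a) (fun p => (points (cx v) bv o p).d) (Φ x) :=
    hgenx.mono fun x h => by simpa only [hconst] using hΦ x h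
  have hmodp : ∀ p, points (fun k => (c k).modify η v) (fun k => (b k).modify η v)
      (fun k => (o k).modify η v) p = (points c b o p).modify η v := by
    rintro (j | j | k) <;> rfl
  have hmod : Generic (points (fun k => (c k).modify η v) (fun k => (b k).modify η v)
      (fun k => (o k).modify η v)) := fun p q hpq => by
    rw [hmodp, hmodp]
    exact hy p q hpq
  obtain ⟨ψ, hψ⟩ := exists_isWordState η hmod
  have hψeq := matrixElement_eq η X hmod hψ
  have hraps : raps (fun k => (c k).modify η v) (fun k => (b k).modify η v)
      (fun k => (o k).modify η v) = fun p => (points c b o p).rap := by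
    funext p
    simp only [raps, hmodp]
    rfl
  rw [hraps] at hψ
  simp only [hmodp] at hψ
  have hpole := regularAt_sub_pole hΦv he hx hv hxv (fun x => congrArg _ (px_eq x))
    (fun x => congrArg _ (pv_eq x)) (fun x p => congrArg _ (pe_eq x p)) hy hyv hι
    (by simpa only [pe_eq, SpectralPoint.modify] using hψ) (letters N X) (nodup_letters N X)
  simp only [px_eq, pv_eq] at hpole
  refine (hpole.const_mul ((((∏ j, (c j).d⁻¹) * dC⁻¹) * ((∏ j, (b j).d⁻¹) * dB⁻¹)))).congr ?_
  filter_upwards [hgenx, hcomm] with x hx1 hx2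
  have hword : Φ x (letters (N + 1) X) =
      Φ x ((px, 1, 0) :: ((letters N X).map (Prod.map e id) ++ [(pv, 0, 1)])) := by
    rw [letters_succ, map_castPoint_letters]
    refine ((hΦ x hx1).append_map_C_cons px
      (List.ofFn fun j : Fin N => Sum.inl j.castSucc) ?_ [] _).trans ?_
    · intro q hq
      obtain ⟨j, rfl⟩ := List.mem_ofFn.mp hq
      have := hx2 j
      simpa only [raps, px_eq, show points (cx x) bv o (Sum.inl j.castSucc) = c j from
        pe_eq x (Sum.inl j)] using this
    · simp only [List.nil_append, List.append_assoc]
      rfl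
  have hF : ∏ k, f η (c k).rap v ≠ 0 := Finset.prod_ne_zero_iff.mpr fun k _ => hfc k
  have hG : ∏ k, f η (b k).rap v ≠ 0 := Finset.prod_ne_zero_iff.mpr fun k _ => hfb k
  have hsin : sin (I * η) = I * sinh η := by rw [mul_comm, sin_mul_I, mul_comm]
  rw [matrixElement_eq η X hx1 (hΦ x hx1), hψeq, hword, hsin]
  simp only [Fin.prod_univ_castSucc, hcx, hbv, Fin.snoc_castSucc, Fin.snoc_last,
    SpectralPoint.modify, mul_inv, Finset.prod_mul_distrib, Finset.prod_inv_distrib]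
  field_simp

end MatrixElements

end XXZ

theorem mainTheorem4 (η : ℂ) (hη : Complex.sinh η ≠ 0) :
    -- the matrix elements are well defined for independent rapidities and vacuum eigenvalues
    (∀ (N M : ℕ) (c b : Fin N → XXZ.SpectralPoint)
      (X : Fin M → Fin 2 × Fin 2) (o : Fin M → XXZ.SpectralPoint),
      XXZ.Generic (XXZ.points c b o) →
        (∃ φ, XXZ.IsVacuumStateAt η c b o φ) ∧
        ∀ φ, XXZ.IsVacuumStateAt η c b o φ →
          φ (XXZ.word η c b X o) = XXZ.matrixElement η c b X o) ∧
    -- they depend on the vacuum eigenvalues at the `λ`'s only through the ratios `l = a / d`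
    (∀ (N M : ℕ) (c b c' b' : Fin N → XXZ.SpectralPoint)
      (X : Fin M → Fin 2 × Fin 2) (o : Fin M → XXZ.SpectralPoint),
      XXZ.Generic (XXZ.points c b o) →
      (∀ j, (c j).d ≠ 0 ∧ (c' j).d ≠ 0 ∧ (c' j).rap = (c j).rap ∧ (c' j).l = (c j).l) →
      (∀ j, (b j).d ≠ 0 ∧ (b' j).d ≠ 0 ∧ (b' j).rap = (b j).rap ∧ (b' j).l = (b j).l) →
        XXZ.matrixElement η c' b' X o = XXZ.matrixElement η c b X o) ∧
    -- the singularity property for `N + 1` particles; `v` is the last rapidity of the state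
    -- and `x → v` the last rapidity of the dual state, at fixed vacuum eigenvalues
    (∀ (N M : ℕ) (c b : Fin N → XXZ.SpectralPoint)
      (X : Fin M → Fin 2 × Fin 2) (o : Fin M → XXZ.SpectralPoint)
      (v aC dC aB dB : ℂ), dC ≠ 0 → dB ≠ 0 →
      (∀ k, (c k).d ≠ 0) → (∀ k, (b k).d ≠ 0) →
      XXZ.Generic (Sum.elim (fun _ : Unit => (⟨v, aB, dB⟩ : XXZ.SpectralPoint))
        (XXZ.points c b o)) →
      (∀ k, XXZ.f η (c k).rap v ≠ 0) → (∀ k, XXZ.f η (b k).rap v ≠ 0) →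
      ∃ h : ℂ → ℂ, AnalyticAt ℂ h v ∧ ∀ᶠ x in nhdsWithin v {v}ᶜ,
        XXZ.matrixElement η
            (Fin.snoc (α := fun _ => XXZ.SpectralPoint) c ⟨x, aC, dC⟩)
            (Fin.snoc (α := fun _ => XXZ.SpectralPoint) b ⟨v, aB, dB⟩) X o =
          (Complex.I * Complex.sinh η * (aB / dB - aC / dC) *
            (∏ k, XXZ.f η (c k).rap v * XXZ.f η (b k).rap v) *
            XXZ.matrixElement η (fun k => (c k).modify η v) (fun k => (b k).modify η v) X
              (fun k => (o k).modify η v)) / (x - v) + h x) := by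
  refine ⟨fun N M c b X o h => ⟨XXZ.exists_isVacuumStateAt η h, fun φ hφ => hφ.apply_word h X⟩,
    fun N M c b c' b' X o h hc hb => XXZ.matrixElement_congr η X h hc hb, ?_⟩
  intro N M c b X o v aC dC aB dB hdC hdB _ _ hgen hfc hfb
  obtain ⟨h, hh, heq⟩ := XXZ.singularity η c b X o v aC dC aB dB hdC hdB hgen hfc hfb
  exact ⟨h, hh, heq.mono fun x hx => by rw [← hx]; ring⟩
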